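/- Let $a,b,c>0$. Let $\mathcal E=\{x^2/a^2+y^2/b^2+z^2/c^2=1\}\subset\mathbb R^3$ be the ellipsoid with semi-axes $a,b,c$, let $S$ be its surface area, that is, $$S=\int_0^{2\pi}\!\!\int_0^{\pi}\sqrt{UV-W^2}\,d\theta\,d\varphi,$$ where $U=|\partial_\theta\mathbf r|^2$, $V=|\partial_\varphi\mathbf r|^2$, $W=\partial_\theta\mathbf r\cdot\partial_\varphi\mathbf r$ for the parametrization $\mathbf r(\theta,\varphi)=(a\cos\theta,\ b\sin\theta\cos\varphi,\ c\sin\theta\sin\varphi)$, and let $\Upsilon$ be the volume of the enclosed region. For a unit vector (direction) $\Psi$, let the central radius $R(\Psi)>0$ be the distance from the centre $0$ to the point $p$ at which the ray from $0$ in the direction $\Psi$ meets $\mathcal E$, and let $H(\Psi)$ be the distance from $0$ to the tangent plane of $\mathcal E$ at $p$. Let $d\Psi$ be the element of solid angle (the surface measure on the unit sphere, of total mass $4\pi$). Then $\Upsilon=\tfrac43\pi abc$, $$\frac{S}{\Upsilon}=3\int\frac1{R(\Psi)}\,\frac{d\Psi}{4\pi},$$ $$S=\int_0^{2\pi}\!\!\int_0^\pi\frac{R^3(\Theta,\Phi)}{H(\Theta,\Phi)}\sin\Theta\,d\Theta\,d\Phi=\int\frac{R^3(\Psi)}{H(\Psi)}\,d\Psi,$$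 the integrals $d\Psi$ being over the full solid angle, and $R(\Theta,\Phi)$, $H(\Theta,\Phi)$ being the values of $R,H$ in the direction $(\cos\Theta,\ \sin\Theta\cos\Phi,\ \sin\Theta\sin\Phi)$. In two dimensions, let $\Lambda=\int_0^{2\pi}|\gamma'(\varphi)|\,d\varphi$, with $\gamma(\varphi)=(a\cos\varphi,\ b\sin\varphi)$, be the length of the ellipse $x^2/a^2+y^2/b^2=1$, let $A$ be the area that it encloses, and let $R(\Phi)$ be the distance from $0$ to the point of the ellipse in the direction $(\cos\Phi,\sin\Phi)$. Then $A=\pi ab$ and $$\frac{\Lambda}{A}=2\int_0^{2\pi}\frac1{R(\Phi)}\,\frac{d\Phi}{2\pi}.$$ -/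

import Mathlib

open MeasureTheory
open scoped Real

noncomputable section

namespace Ellipsoid

/-- The quadratic form `∑ xᵢ² / sᵢ²` of the ellipsoid with principal semi-axes `s`. -/
def form {n : ℕ} (s : Fin n → ℝ) (x : EuclideanSpace ℝ (Fin n)) : ℝ :=
  ∑ i, x i ^ 2 / s i ^ 2

/-- The ellipsoid (an ellipse if `n = 2`) as a hypersurface: `∑ xᵢ² / sᵢ² = 1`. -/
def surface {n : ℕ} (s : Fin n → ℝ) : Set (EuclideanSpace ℝ (Fin n)) :=
  {x | form s x = 1}

/-- The region enclosed by the ellipsoid: `∑ xᵢ² / sᵢ² ≤ 1`. -/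
def solid {n : ℕ} (s : Fin n → ℝ) : Set (EuclideanSpace ℝ (Fin n)) :=
  {x | form s x ≤ 1}

/-- The central radius in the direction `u` (a unit vector): the distance from the centre of the
point where the ray from the centre in the direction `u` meets the ellipsoid. The set below is a
singleton, see `ray_inter_surface`. -/
def centralRadius {n : ℕ} (s : Fin n → ℝ) (u : EuclideanSpace ℝ (Fin n)) : ℝ :=
  sSup {t : ℝ | 0 ≤ t ∧ t • u ∈ surface s}

/-- The tangent hyperplane of the ellipsoid at the point `p`: the points `q` such that `q - p` is
in the kernel of the differential at `p` of the defining function. -/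
def tangentPlane {n : ℕ} (s : Fin n → ℝ) (p : EuclideanSpace ℝ (Fin n)) :
    Set (EuclideanSpace ℝ (Fin n)) :=
  {q | fderiv ℝ (form s) p (q - p) = 0}

/-- The height in the direction `u`: the shortest distance from the centre to the tangent
hyperplane at the point of the ellipsoid in the direction `u`. -/
def height {n : ℕ} (s : Fin n → ℝ) (u : EuclideanSpace ℝ (Fin n)) : ℝ :=
  Metric.infDist 0 (tangentPlane s (centralRadius s u • u))

/-- The solid angle: the surface measure of the unit sphere of three-dimensional Euclidean space,
of total mass `4π`. -/
def solidAngle : Measure (Metric.sphere (0 : EuclideanSpace ℝ (Fin 3)) 1) :=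
  (volume : Measure (EuclideanSpace ℝ (Fin 3))).toSphere

/-- The unit vector of co-latitude `Θ` (from the first axis) and longitude `Φ`. -/
def direction (Θ Φ : ℝ) : EuclideanSpace ℝ (Fin 3) :=
  !₂[Real.cos Θ, Real.sin Θ * Real.cos Φ, Real.sin Θ * Real.sin Φ]

/-- The unit vector of the plane of polar angle `Φ`. -/
def planeDirection (Φ : ℝ) : EuclideanSpace ℝ (Fin 2) :=
  !₂[Real.cos Φ, Real.sin Φ]

/-- The area element `√(U V - W²)` of a parametrized surface `r`, where `U`, `V`, `W` are the
coefficients of its first fundamental form. -/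
def areaElement (r : ℝ → ℝ → EuclideanSpace ℝ (Fin 3)) (θ φ : ℝ) : ℝ :=
  √(‖deriv (fun t => r t φ) θ‖ ^ 2 * ‖deriv (fun t => r θ t) φ‖ ^ 2
    - inner ℝ (deriv (fun t => r t φ) θ) (deriv (fun t => r θ t) φ) ^ 2)

/-- The parametrization of the ellipsoid by the eccentric anomalies. It covers the ellipsoid, and
covers it only once up to the poles and one meridian, see `param_image` and `param_injOn`. -/
def param (a b c θ φ : ℝ) : EuclideanSpace ℝ (Fin 3) :=
  !₂[a * Real.cos θ, b * Real.sin θ * Real.cos φ, c * Real.sin θ * Real.sin φ]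

/-- The surface area of the ellipsoid with semi-axes `a`, `b`, `c`. -/
def surfaceArea (a b c : ℝ) : ℝ :=
  ∫ φ in (0 : ℝ)..2 * π, ∫ θ in (0 : ℝ)..π, areaElement (param a b c) θ φ

/-- The parametrization of the ellipse by the eccentric anomaly, see `planeParam_bijOn`. -/
def planeParam (a b φ : ℝ) : EuclideanSpace ℝ (Fin 2) :=
  !₂[a * Real.cos φ, b * Real.sin φ]

/-- The length of the ellipse with semi-axes `a`, `b`. -/
def ellipseLength (a b : ℝ) : ℝ :=
  ∫ φ in (0 : ℝ)..2 * π, ‖deriv (planeParam a b) φ‖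

/-- For a unit vector `u`, the ray in the direction `u` meets the ellipsoid at exactly one point,
at the (positive) distance `centralRadius s u` from the centre. -/
theorem ray_inter_surface {n : ℕ} (s : Fin n → ℝ) (hs : ∀ i, 0 < s i)
    (u : EuclideanSpace ℝ (Fin n)) (hu : ‖u‖ = 1) :
    0 < centralRadius s u ∧
      {t : ℝ | 0 ≤ t ∧ t • u ∈ surface s} = {centralRadius s u} := by
  have hscale : ∀ t : ℝ, form s (t • u) = t ^ 2 * form s u := by
    intro t
    simp only [form, Finset.mul_sum, PiLp.smul_apply, smul_eq_mul]
    exact Finset.sum_congr rfl fun i _ => by ring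
  have hpos : 0 < form s u := by
    obtain ⟨i, hi⟩ : ∃ i, u i ≠ 0 := by
      by_contra! h
      have : u = 0 := by ext i; simpa using h i
      simp [this] at hu
    refine Finset.sum_pos' (fun j _ => by positivity) ⟨i, Finset.mem_univ i, ?_⟩
    have := hs i
    positivity
  have hset : {t : ℝ | 0 ≤ t ∧ t • u ∈ surface s} = {1 / √(form s u)} := by
    ext t
    simp only [surface, Set.mem_ofPred_eq, hscale, Set.mem_singleton_iff]
    have hq : 0 < √(form s u) := Real.sqrt_pos.2 hpos
    have hsq : √(form s u) ^ 2 = form s u := Real.sq_sqrt hpos.le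
    rw [eq_div_iff hq.ne', show t ^ 2 * form s u = (t * √(form s u)) ^ 2 by rw [mul_pow, hsq]]
    constructor
    · rintro ⟨h0, h1⟩
      have h2 : 0 ≤ t * √(form s u) := by positivity
      exact (pow_eq_one_iff_of_nonneg h2 two_ne_zero).1 h1
    · intro h
      refine ⟨?_, by simp [h]⟩
      by_contra! ht
      nlinarith
  have hR : centralRadius s u = 1 / √(form s u) := by
    rw [centralRadius, hset, csSup_singleton]
  rw [hR]
  exact ⟨by positivity, hset⟩

/-- Every point of the unit circle has exactly one angle in `[0, 2π)`. -/
theorem exists_angle (x y : ℝ) (h : x ^ 2 + y ^ 2 = 1) :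
    ∃ φ ∈ Set.Ico 0 (2 * π), Real.cos φ = x ∧ Real.sin φ = y := by
  have hn : ‖(⟨x, y⟩ : ℂ)‖ = 1 := by
    rw [Complex.norm_def, Complex.normSq_mk, Real.sqrt_eq_one]; linarith
  have h0 : (⟨x, y⟩ : ℂ) ≠ 0 := by intro h'; simp [h'] at hn
  have hc := Complex.cos_arg h0
  have hs := Complex.sin_arg (⟨x, y⟩ : ℂ)
  rw [hn] at hc hs
  have := Complex.neg_pi_lt_arg (⟨x, y⟩ : ℂ)
  have := Complex.arg_le_pi (⟨x, y⟩ : ℂ)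
  rcases le_or_gt 0 (Complex.arg ⟨x, y⟩) with h1 | h1
  · exact ⟨_, ⟨h1, by linarith [Real.pi_pos]⟩, by simpa using hc, by simpa using hs⟩
  · exact ⟨Complex.arg ⟨x, y⟩ + 2 * π, ⟨by linarith, by linarith⟩,
      by simpa using hc, by simpa using hs⟩

theorem angle_unique {φ ψ : ℝ} (hφ : φ ∈ Set.Ico 0 (2 * π)) (hψ : ψ ∈ Set.Ico 0 (2 * π))
    (hc : Real.cos φ = Real.cos ψ) (hs : Real.sin φ = Real.sin ψ) : φ = ψ := by
  have h : Real.cos (φ - ψ) = 1 := by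
    rw [Real.cos_sub, hc, hs]; nlinarith [Real.sin_sq_add_cos_sq ψ]
  have := (Real.cos_eq_one_iff_of_lt_of_lt (by linarith [hφ.1, hψ.2])
    (by linarith [hφ.2, hψ.1])).1 h
  linarith

/-- The eccentric anomalies `θ ∈ [0, π]`, `φ ∈ [0, 2π)` cover the ellipsoid. -/
theorem param_image (a b c : ℝ) (ha : 0 < a) (hb : 0 < b) (hc : 0 < c) :
    (fun q : ℝ × ℝ => param a b c q.1 q.2) '' (Set.Icc 0 π ×ˢ Set.Ico 0 (2 * π)) =
      surface ![a, b, c] := by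
  ext x
  simp only [Set.mem_image, Prod.exists, Set.mem_prod]
  constructor
  · rintro ⟨θ, φ, -, rfl⟩
    simp only [surface, form, param, Fin.sum_univ_three, Set.mem_ofPred_eq]
    simp
    field_simp
    nlinarith [Real.sin_sq_add_cos_sq θ, Real.sin_sq_add_cos_sq φ]
  · intro hx
    simp only [surface, form, Fin.sum_univ_three, Set.mem_ofPred_eq] at hx
    simp only [Matrix.cons_val] at hx
    have hx' : (x 0 / a) ^ 2 + (x 1 / b) ^ 2 + (x 2 / c) ^ 2 = 1 := by
      simpa only [div_pow] using hx
    set X := x 0 / a with hX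
    set Y := x 1 / b with hY
    set Z := x 2 / c with hZ
    have hθ : Real.cos (Real.arccos X) = X := Real.cos_arccos (by nlinarith) (by nlinarith)
    have hr0 : 0 ≤ Real.sin (Real.arccos X) :=
      Real.sin_nonneg_of_nonneg_of_le_pi (Real.arccos_nonneg _) (Real.arccos_le_pi _)
    have hr : Real.sin (Real.arccos X) ^ 2 = Y ^ 2 + Z ^ 2 := by
      have := Real.sin_sq_add_cos_sq (Real.arccos X)
      rw [hθ] at this; linarith
    set r := Real.sin (Real.arccos X) with hrdef
    obtain ⟨φ, hφ, h1, h2⟩ : ∃ φ ∈ Set.Ico 0 (2 * π), r * Real.cos φ = Y ∧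
        r * Real.sin φ = Z := by
      rcases hr0.eq_or_lt with h | h
      · refine ⟨0, ⟨le_rfl, by positivity⟩, ?_, ?_⟩ <;> rw [← h] at hr ⊢ <;> nlinarith
      · obtain ⟨φ, hφ, h1, h2⟩ := exists_angle (Y / r) (Z / r) (by field_simp; linarith)
        exact ⟨φ, hφ, by rw [h1]; field_simp, by rw [h2]; field_simp⟩
    refine ⟨Real.arccos X, φ, ⟨⟨Real.arccos_nonneg _, Real.arccos_le_pi _⟩, hφ⟩, ?_⟩
    ext i
    fin_cases i
    · change a * Real.cos (Real.arccos X) = x 0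
      rw [hθ, hX]; field_simp
    · simp [param, ← hrdef, mul_assoc, h1, hY]; field_simp
    · simp [param, ← hrdef, mul_assoc, h2, hZ]; field_simp

/-- Off the poles, the eccentric anomalies of a point of the ellipsoid are unique. -/
theorem param_injOn (a b c : ℝ) (ha : 0 < a) (hb : 0 < b) (hc : 0 < c) :
    Set.InjOn (fun q : ℝ × ℝ => param a b c q.1 q.2) (Set.Ioo 0 π ×ˢ Set.Ico 0 (2 * π)) := by
  rintro ⟨θ, φ⟩ ⟨hθ, hφ⟩ ⟨θ', φ'⟩ ⟨hθ', hφ'⟩ h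
  have h0 := congrArg (fun x : EuclideanSpace ℝ (Fin 3) => x 0) h
  have h1 := congrArg (fun x : EuclideanSpace ℝ (Fin 3) => x 1) h
  have h2 := congrArg (fun x : EuclideanSpace ℝ (Fin 3) => x 2) h
  simp [param, ha.ne'] at h0 h1 h2
  have e : θ = θ' := Real.injOn_cos ⟨hθ.1.le, hθ.2.le⟩ ⟨hθ'.1.le, hθ'.2.le⟩ h0
  subst e
  have hs : Real.sin θ ≠ 0 := (Real.sin_pos_of_pos_of_lt_pi hθ.1 hθ.2).ne'
  have e : φ = φ' := angle_unique hφ hφ'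
    (mul_left_cancel₀ (mul_ne_zero hb.ne' hs) h1) (mul_left_cancel₀ (mul_ne_zero hc.ne' hs) h2)
  rw [e]

/-- The eccentric anomaly `φ ∈ [0, 2π)` runs through the ellipse exactly once. -/
theorem planeParam_bijOn (a b : ℝ) (ha : 0 < a) (hb : 0 < b) :
    Set.BijOn (planeParam a b) (Set.Ico 0 (2 * π)) (surface ![a, b]) := by
  refine ⟨fun φ _ => ?_, fun φ hφ φ' hφ' h => ?_, fun x hx => ?_⟩
  · simp only [surface, form, planeParam, Fin.sum_univ_two, Set.mem_ofPred_eq]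
    simp
    field_simp
    nlinarith [Real.sin_sq_add_cos_sq φ]
  · have h0 := congrArg (fun x : EuclideanSpace ℝ (Fin 2) => x 0) h
    have h1 := congrArg (fun x : EuclideanSpace ℝ (Fin 2) => x 1) h
    simp [planeParam, ha.ne', hb.ne'] at h0 h1
    exact angle_unique hφ hφ' h0 h1
  · simp only [surface, form, Fin.sum_univ_two, Set.mem_ofPred_eq] at hx
    simp only [Matrix.cons_val] at hx
    obtain ⟨φ, hφ, h1, h2⟩ := exists_angle (x 0 / a) (x 1 / b) (by simpa only [div_pow] using hx)
    refine ⟨φ, hφ, ?_⟩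
    ext i
    fin_cases i
    · simp [planeParam, h1]; field_simp
    · simp [planeParam, h2]; field_simp

end Ellipsoid

end

/-! Everything is expressed through the diagonal map `N = normalize s`, which takes the ellipsoid to
the unit sphere. For a unit vector `u`, the central radius is `1 / ‖N u‖`. The tangent plane at `p`
is `⟪N (N p), q⟫ = 1`, so the height is `‖N u‖ / ‖N (N u)‖`, and `R ^ 3 / H` becomes `‖N (N u)‖ / ‖N
u‖ ^ 4`.

The area element in the eccentric anomalies is `a b c ‖N u‖ sin θ`, where `u` is the direction whose
spherical angles are those same anomalies (`areaElement_param`). Hence `S = a b c ∫ ‖N u‖ dΨ`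
(`surfaceArea_eq`). Dividing by the volume gives the mean of `1 / R`; the ellipse works in the same
way.

In the formula with `R ^ 3 / H` the angles are the true ones. The bridge is
`lintegral_norm_normalize_duality`: integrate `‖N y‖` over the unit ball and `‖N (N x)‖` over the
region enclosed by the ellipsoid. The substitution `y = N x` relates the two with Jacobian factor `a
b c`, and integrating out the radius leaves `∫ ‖N u‖` and `∫ ‖N (N u)‖ / ‖N u‖ ^ 4`, each with the
factor `1 / 4`. -/

noncomputable section

namespace Ellipsoid

/-! ### Polar and spherical coordinates -/

/-- The moment `∫₀ᴿ rⁿ dr`, as a Lebesgue integral. -/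
theorem lintegral_Ioi_pow_mul_indicator (n : ℕ) {R : ℝ} (hR : 0 ≤ R) :
    ∫⁻ r in Set.Ioi (0 : ℝ), ENNReal.ofReal (r ^ n) * (Set.Iio R).indicator 1 r =
      ENNReal.ofReal (R ^ (n + 1) / (n + 1)) := by
  have h : ∀ r : ℝ, ENNReal.ofReal (r ^ n) * (Set.Iio R).indicator 1 r =
      (Set.Iio R).indicator (fun r => ENNReal.ofReal (r ^ n)) r := by
    intro r
    by_cases hr : r ∈ Set.Iio R <;> simp [hr]
  simp_rw [h]
  rw [lintegral_indicator measurableSet_Iio, Measure.restrict_restrict measurableSet_Iio,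
    Set.inter_comm, Set.Ioi_inter_Iio, Measure.restrict_congr_set Ioo_ae_eq_Ioc,
    ← ofReal_integral_eq_lintegral_ofReal (intervalIntegral.intervalIntegrable_pow _).1,
    ← intervalIntegral.integral_of_le hR]
  · simp
  · filter_upwards [ae_restrict_mem measurableSet_Ioc] with y hy
    exact pow_nonneg hy.1.le _

/-- Integration in polar coordinates on a normed space. -/
theorem lintegral_eq_lintegral_toSphere {E : Type*} [NormedAddCommGroup E] [NormedSpace ℝ E]
    [MeasurableSpace E] [BorelSpace E] [FiniteDimensional ℝ E] [Nontrivial E] (μ : Measure E)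
    [μ.IsAddHaarMeasure] {F : E → ENNReal} (hF : Measurable F) :
    ∫⁻ x, F x ∂μ = ∫⁻ u, ∫⁻ r in Set.Ioi (0 : ℝ),
      ENNReal.ofReal (r ^ (Module.finrank ℝ E - 1)) * F (r • (u : E)) ∂volume ∂μ.toSphere := by
  calc
    ∫⁻ x, F x ∂μ = ∫⁻ x : ({(0)}ᶜ : Set E), F x.1 ∂(μ.comap (↑)) := by
      rw [lintegral_subtype_comap (measurableSet_singleton _).compl, restrict_compl_singleton]
    _ = ∫⁻ q, F (q.2.1 • (q.1 : E)) ∂μ.toSphere.prod (.volumeIoiPow (Module.finrank ℝ E - 1)) := by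
      rw [← μ.measurePreserving_homeomorphUnitSphereProd.lintegral_comp_emb
        (Homeomorph.measurableEmbedding _)]
      refine lintegral_congr fun x => ?_
      congr 1
      exact (congrArg Subtype.val ((homeomorphUnitSphereProd E).symm_apply_apply x)).symm
    _ = ∫⁻ u, ∫⁻ r : Set.Ioi (0 : ℝ), F (r.1 • (u : E))
          ∂(.volumeIoiPow (Module.finrank ℝ E - 1)) ∂μ.toSphere :=
      lintegral_prod _ (by fun_prop)
    _ = _ := by
      refine lintegral_congr fun u => ?_
      rw [Measure.volumeIoiPow, lintegral_withDensity_eq_lintegral_mul _ (by fun_prop)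
        (by fun_prop)]
      exact lintegral_subtype_comap measurableSet_Ioi fun r : ℝ =>
        ENNReal.ofReal (r ^ (Module.finrank ℝ E - 1)) * F (r • (u : E))

/-- The integral of a function on `ℝ³` as an iterated integral. -/
theorem lintegral_euclideanSpace_three (F : EuclideanSpace ℝ (Fin 3) → ENNReal)
    (hF : Measurable F) :
    ∫⁻ x, F x = ∫⁻ x : ℝ, ∫⁻ p : ℝ × ℝ, F !₂[x, p.1, p.2] := by
  rw [← (PiLp.volume_preserving_toLp (Fin 3)).lintegral_comp hF,
    ← (volume_preserving_piFinSuccAbove (fun _ : Fin 3 => ℝ) 0).symm.lintegral_comp (by fun_prop),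
    Measure.volume_eq_prod, lintegral_prod _ (by fun_prop)]
  refine lintegral_congr fun x => ?_
  rw [← (volume_preserving_finTwoArrow ℝ).symm.lintegral_comp (by fun_prop)]
  refine lintegral_congr fun p => ?_
  congr 2
  ext i
  fin_cases i <;> rfl

/-- Integration in spherical coordinates, with the first axis as polar axis. -/
theorem lintegral_eq_lintegral_direction (F : EuclideanSpace ℝ (Fin 3) → ENNReal)
    (hF : Measurable F) :
    ∫⁻ x, F x = ∫⁻ φ in Set.Ioo (-π) π, ∫⁻ θ in Set.Ioo 0 π,
      ENNReal.ofReal (Real.sin θ) *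
        ∫⁻ r in Set.Ioi (0 : ℝ), ENNReal.ofReal (r ^ 2) * F (r • direction θ φ) := by
  have hvec : Measurable fun q : ℝ × ℝ × ℝ => (!₂[q.1, q.2.1, q.2.2] : EuclideanSpace ℝ (Fin 3)) :=
    (by fun_prop : Continuous _).measurable
  have hF3 : Measurable fun q : ℝ × ℝ × ℝ => F !₂[q.1, q.2.1, q.2.2] := hF.comp hvec
  have hF3' : ∀ {α : Type} [MeasurableSpace α] {f g h : α → ℝ}, Measurable f → Measurable g →
      Measurable h → Measurable fun a => F !₂[f a, g a, h a] :=
    fun hf hg hh => hF3.comp (hf.prodMk (hg.prodMk hh))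
  -- Polar coordinates are used twice: in the plane of the last two coordinates, then in the
  -- half-plane of the first axis and `ρ > 0`. The Jacobians `ρ = r sin θ` and `r` multiply to `r ^
  -- 2 sin θ`.
  calc
    ∫⁻ x, F x = ∫⁻ x : ℝ, ∫⁻ φ in Set.Ioo (-π) π, ∫⁻ ρ in Set.Ioi (0 : ℝ),
        ENNReal.ofReal ρ * F !₂[x, ρ * Real.cos φ, ρ * Real.sin φ] := by
      rw [lintegral_euclideanSpace_three F hF]
      refine lintegral_congr fun x => ?_
      rw [← lintegral_comp_polarCoord_symm, polarCoord_target, Measure.volume_eq_prod,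
        ← Measure.prod_restrict, lintegral_prod_symm]
      · simp [polarCoord_symm_apply]
      · simp only [polarCoord_symm_apply]
        exact ((by fun_prop : Measurable fun p : ℝ × ℝ => ENNReal.ofReal p.1).mul
          (hF3' (by fun_prop) (by fun_prop) (by fun_prop))).aemeasurable
    _ = ∫⁻ φ in Set.Ioo (-π) π, ∫⁻ x : ℝ, ∫⁻ ρ in Set.Ioi (0 : ℝ),
        ENNReal.ofReal ρ * F !₂[x, ρ * Real.cos φ, ρ * Real.sin φ] := by
      refine lintegral_lintegral_swap (Measurable.aemeasurable ?_)
      refine Measurable.lintegral_prod_right' (f := fun q : (ℝ × ℝ) × ℝ => ENNReal.ofReal q.2 *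
        F !₂[q.1.1, q.2 * Real.cos q.1.2, q.2 * Real.sin q.1.2]) ?_
      exact (by fun_prop : Measurable fun p : (ℝ × ℝ) × ℝ => ENNReal.ofReal p.2).mul
          (hF3' (by fun_prop) (by fun_prop) (by fun_prop))
    _ = _ := by
      refine lintegral_congr fun φ => ?_
      -- Extension by zero to the whole plane makes the polar change of variables applicable; the
      -- condition `ρ > 0` then cuts the angle from `(-π, π)` down to `(0, π)`.
      set G : ℝ × ℝ → ENNReal := fun q => (Set.Ioi (0 : ℝ)).indicator 1 q.2 *
        (ENNReal.ofReal q.2 * F !₂[q.1, q.2 * Real.cos φ, q.2 * Real.sin φ]) with hG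
      have hGm : Measurable G := by
        refine Measurable.mul ?_ ((by fun_prop : Measurable fun p : ℝ × ℝ =>
          ENNReal.ofReal p.2).mul (hF3' (by fun_prop) (by fun_prop) (by fun_prop)))
        exact (measurable_one.indicator measurableSet_Ioi).comp measurable_snd
      have h1 : ∀ x, ∫⁻ ρ in Set.Ioi (0 : ℝ),
          ENNReal.ofReal ρ * F !₂[x, ρ * Real.cos φ, ρ * Real.sin φ] = ∫⁻ ρ, G (x, ρ) := by
        intro x
        rw [← lintegral_indicator measurableSet_Ioi]
        refine lintegral_congr fun ρ => ?_
        by_cases h : ρ ∈ Set.Ioi (0 : ℝ) <;> simp [hG, h]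
      simp_rw [h1]
      rw [← lintegral_prod _ hGm.aemeasurable, ← Measure.volume_eq_prod,
        ← lintegral_comp_polarCoord_symm, polarCoord_target, Measure.volume_eq_prod,
        ← Measure.prod_restrict, lintegral_prod_symm]
      · rw [← lintegral_indicator measurableSet_Ioo, ← lintegral_indicator measurableSet_Ioo]
        refine lintegral_congr fun θ => ?_
        by_cases h : θ ∈ Set.Ioo 0 π
        · have hs : 0 < Real.sin θ := Real.sin_pos_of_pos_of_lt_pi h.1 h.2
          have h' : θ ∈ Set.Ioo (-π) π := ⟨by linarith [h.1, Real.pi_pos], h.2⟩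
          rw [Set.indicator_of_mem h, Set.indicator_of_mem h',
            ← lintegral_const_mul' _ _ ENNReal.ofReal_ne_top]
          refine setLIntegral_congr_fun measurableSet_Ioi fun r hr => ?_
          have hr : 0 < r := hr
          have hv : (!₂[r * Real.cos θ, r * Real.sin θ * Real.cos φ, r * Real.sin θ * Real.sin φ] :
              EuclideanSpace ℝ (Fin 3)) = r • direction θ φ := by
            ext i
            fin_cases i <;> simp [direction, mul_assoc]
          have hp : 0 < r * Real.sin θ := by positivity
          simp only [hG, polarCoord_symm_apply, smul_eq_mul, Set.indicator_of_mem
            (show r * Real.sin θ ∈ Set.Ioi (0 : ℝ) from hp), Pi.one_apply, one_mul, hv]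
          rw [← mul_assoc, ← mul_assoc, ← ENNReal.ofReal_mul hr.le, ← ENNReal.ofReal_mul hs.le]
          congr 2
          ring
        · rw [Set.indicator_of_notMem h]
          by_cases h' : θ ∈ Set.Ioo (-π) π
          · rw [Set.indicator_of_mem h']
            refine (setLIntegral_congr_fun measurableSet_Ioi fun r hr => ?_).trans lintegral_zero
            have hθ : θ ≤ 0 := not_lt.1 fun h0 => h ⟨h0, h'.2⟩
            have hs : Real.sin θ ≤ 0 := Real.sin_nonpos_of_nonpos_of_neg_pi_le hθ h'.1.le
            have hp : r * Real.sin θ ≤ 0 := mul_nonpos_of_nonneg_of_nonpos (le_of_lt hr) hs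
            simp [hG, polarCoord_symm_apply, hp]
          · rw [Set.indicator_of_notMem h']
      · simp only [polarCoord_symm_apply]
        exact ((by fun_prop : Measurable fun p : ℝ × ℝ => ENNReal.ofReal p.1).mul
          (hGm.comp (by fun_prop))).aemeasurable

theorem norm_direction (θ φ : ℝ) : ‖direction θ φ‖ = 1 := by
  rw [EuclideanSpace.norm_eq, Real.sqrt_eq_one, Fin.sum_univ_three]
  simp only [direction, Real.norm_eq_abs, sq_abs]
  simp only [Matrix.cons_val]
  linear_combination Real.sin θ ^ 2 * Real.sin_sq_add_cos_sq φ + Real.sin_sq_add_cos_sq θ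

/-- The solid angle in spherical coordinates. -/
theorem lintegral_solidAngle (f : EuclideanSpace ℝ (Fin 3) → ENNReal) (hf : Measurable f) :
    ∫⁻ u, f u ∂solidAngle = ∫⁻ φ in Set.Ioo (-π) π, ∫⁻ θ in Set.Ioo 0 π,
      ENNReal.ofReal (Real.sin θ) * f (direction θ φ) := by
  -- The degree-zero extension of `f`, cut off at the unit ball. Its integral is computed by the
  -- abstract polar decomposition and by spherical coordinates; both yield the radial factor `k = 1
  -- / 3`, which cancels.
  set F : EuclideanSpace ℝ (Fin 3) → ENNReal :=
    fun x => f (‖x‖⁻¹ • x) * (Set.Iio (1 : ℝ)).indicator 1 ‖x‖ with hF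
  have hFm : Measurable F := (hf.comp (by fun_prop)).mul
    ((measurable_one.indicator measurableSet_Iio).comp measurable_norm)
  set k : ENNReal := ENNReal.ofReal ((1 : ℝ) ^ (2 + 1) / ((2 : ℕ) + 1)) with hk
  have hk0 : k ≠ 0 := by simp [hk]; norm_num
  have hkt : k ≠ ⊤ := ENNReal.ofReal_ne_top
  have hray : ∀ u : EuclideanSpace ℝ (Fin 3), ‖u‖ = 1 →
      ∫⁻ r in Set.Ioi (0 : ℝ), ENNReal.ofReal (r ^ 2) * F (r • u) = k * f u := by
    intro u hu
    rw [hk, ← lintegral_Ioi_pow_mul_indicator 2 zero_le_one, ← lintegral_mul_const]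
    · refine setLIntegral_congr_fun measurableSet_Ioi fun r hr => ?_
      have hr : 0 < r := hr
      simp only [hF, norm_smul, hu, Real.norm_eq_abs, abs_of_pos hr, mul_one, smul_smul,
        inv_mul_cancel₀ hr.ne', one_smul]
      ring
    · exact (by fun_prop : Measurable fun r : ℝ => ENNReal.ofReal (r ^ 2)).mul
        (measurable_one.indicator measurableSet_Iio)
  have h1 := lintegral_eq_lintegral_toSphere volume hFm
  rw [lintegral_eq_lintegral_direction F hFm, finrank_euclideanSpace_fin] at h1
  simp_rw [hray _ (norm_direction _ _), hray _ (norm_eq_of_mem_sphere _), mul_left_comm _ k,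
    lintegral_const_mul' _ _ hkt] at h1
  exact ((ENNReal.mul_right_inj hk0 hkt).1 h1).symm

/-! ### Central radius and height through the diagonal map -/

/-- The diagonal map `xᵢ ↦ xᵢ / sᵢ`, which takes the ellipsoid to the unit sphere. -/
def normalize {n : ℕ} (s : Fin n → ℝ) :
    EuclideanSpace ℝ (Fin n) →ₗ[ℝ] EuclideanSpace ℝ (Fin n) :=
  Matrix.toEuclideanLin (Matrix.diagonal fun i => (s i)⁻¹)

theorem normalize_apply {n : ℕ} (s : Fin n → ℝ) (x : EuclideanSpace ℝ (Fin n)) (i : Fin n) :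
    normalize s x i = x i / s i := by
  simp [normalize, Matrix.toLpLin_apply, Matrix.mulVec_diagonal, div_eq_inv_mul]

theorem continuous_normalize {n : ℕ} (s : Fin n → ℝ) : Continuous (normalize s) :=
  LinearMap.continuous_of_finiteDimensional _

theorem det_normalize {n : ℕ} (s : Fin n → ℝ) :
    LinearMap.det (normalize s) = ∏ i, (s i)⁻¹ := by
  rw [normalize, Matrix.toEuclideanLin_eq_toLin_orthonormal, LinearMap.det_toLin,
    Matrix.det_diagonal]

theorem norm_normalize_sq {n : ℕ} (s : Fin n → ℝ) (x : EuclideanSpace ℝ (Fin n)) :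
    ‖normalize s x‖ ^ 2 = form s x := by
  simp [EuclideanSpace.norm_sq_eq, form, normalize_apply, div_pow]

theorem normalize_ne_zero {n : ℕ} {s : Fin n → ℝ} (hs : ∀ i, 0 < s i)
    {x : EuclideanSpace ℝ (Fin n)} (hx : x ≠ 0) : normalize s x ≠ 0 := by
  contrapose! hx
  ext i
  have h := congrArg (fun y : EuclideanSpace ℝ (Fin n) => y i) hx
  simpa [normalize_apply, (hs i).ne'] using h

/-- The central radius in the direction `u` is `1 / √(∑ uᵢ² / sᵢ²)`. -/
theorem centralRadius_eq {n : ℕ} {s : Fin n → ℝ} (hs : ∀ i, 0 < s i)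
    {u : EuclideanSpace ℝ (Fin n)} (hu : ‖u‖ = 1) : centralRadius s u = ‖normalize s u‖⁻¹ := by
  have hu0 : u ≠ 0 := by rintro rfl; simp at hu
  have hpos : 0 < ‖normalize s u‖ := norm_pos_iff.2 (normalize_ne_zero hs hu0)
  have hmem : ‖normalize s u‖⁻¹ ∈ {t : ℝ | 0 ≤ t ∧ t • u ∈ surface s} := by
    refine ⟨by positivity, ?_⟩
    rw [surface, Set.mem_ofPred_eq, ← norm_normalize_sq, map_smul, norm_smul, norm_inv, norm_norm,
      inv_mul_cancel₀ hpos.ne', one_pow]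
  rw [(ray_inter_surface s hs u hu).2] at hmem
  exact (Set.mem_singleton_iff.1 hmem).symm

/-- The distance from the origin to the hyperplane `⟪g, q⟫ = 1`. -/
theorem infDist_zero_hyperplane {E : Type*} [NormedAddCommGroup E] [InnerProductSpace ℝ E]
    {g : E} (hg : g ≠ 0) : Metric.infDist 0 {q : E | inner ℝ g q = 1} = ‖g‖⁻¹ := by
  have hpos : 0 < ‖g‖ := norm_pos_iff.2 hg
  -- The foot of the perpendicular from the origin; that no point is closer is Cauchy–Schwarz.
  have hmem : (‖g‖ ^ 2)⁻¹ • g ∈ {q : E | inner ℝ g q = 1} := by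
    simp [inner_smul_right, hg]
  refine le_antisymm ?_ ?_
  · refine (Metric.infDist_le_dist_of_mem hmem).trans_eq ?_
    rw [dist_zero_left, norm_smul, norm_inv, norm_pow, norm_norm]
    field_simp
  · refine (Metric.le_infDist ⟨_, hmem⟩).2 fun q hq => ?_
    have h := real_inner_le_norm g q
    rw [show inner ℝ g q = 1 from hq] at h
    rw [dist_zero_left, inv_le_iff_one_le_mul₀ hpos]
    linarith

/-- The form is the squared norm of a linear map, so its differential is that of `‖·‖ ^ 2` composed
with the map. -/
theorem fderiv_form {n : ℕ} (s : Fin n → ℝ) (p v : EuclideanSpace ℝ (Fin n)) :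
    fderiv ℝ (form s) p v = 2 * inner ℝ (normalize s p) (normalize s v) := by
  have h : form s = fun x => ‖(normalize s).toContinuousLinearMap x‖ ^ 2 :=
    funext fun x => (norm_normalize_sq s x).symm
  have hd := ((normalize s).toContinuousLinearMap.hasFDerivAt (x := p)).norm_sq
  rw [h, hd.fderiv]
  simp

/-- A diagonal map is self-adjoint. This exhibits the normal vector of the tangent plane. -/
theorem inner_normalize {n : ℕ} (s : Fin n → ℝ) (x y : EuclideanSpace ℝ (Fin n)) :
    inner ℝ (normalize s x) (normalize s y) = inner ℝ (normalize s (normalize s x)) y := by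
  simp only [PiLp.inner_apply, normalize_apply]
  refine Finset.sum_congr rfl fun i _ => ?_
  simp
  ring

/-- At the point `p = u / ‖N u‖` of the ellipsoid, `⟪N p, N p⟫ = 1` turns the tangency condition
into `⟪N (N p), q⟫ = 1`, a plane at distance `1 / ‖N (N p)‖` from the centre. -/
theorem height_eq {n : ℕ} {s : Fin n → ℝ} (hs : ∀ i, 0 < s i)
    {u : EuclideanSpace ℝ (Fin n)} (hu : ‖u‖ = 1) :
    height s u = ‖normalize s u‖ / ‖normalize s (normalize s u)‖ := by
  have hu0 : u ≠ 0 := by rintro rfl; simp at hu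
  have hn := normalize_ne_zero hs hu0
  have hnn := normalize_ne_zero hs hn
  have hpos : 0 < ‖normalize s u‖ := norm_pos_iff.2 hn
  set p := ‖normalize s u‖⁻¹ • u with hp
  have hp1 : inner ℝ (normalize s p) (normalize s p) = 1 := by
    rw [real_inner_self_eq_norm_sq, hp, map_smul, norm_smul, norm_inv, norm_norm,
      inv_mul_cancel₀ hpos.ne', one_pow]
  have hplane : tangentPlane s p = {q | inner ℝ (normalize s (normalize s p)) q = 1} := by
    ext q
    rw [tangentPlane, Set.mem_ofPred_eq, Set.mem_ofPred_eq, fderiv_form, map_sub, inner_sub_right,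
      hp1, ← inner_normalize]
    constructor <;> intro h <;> linarith
  have hg : normalize s (normalize s p) = ‖normalize s u‖⁻¹ • normalize s (normalize s u) := by
    rw [hp, map_smul, map_smul]
  rw [height, centralRadius_eq hs hu, ← hp, hplane, infDist_zero_hyperplane, hg, norm_smul,
    norm_inv, norm_norm, mul_inv, inv_inv, div_eq_mul_inv]
  rw [hg]
  exact smul_ne_zero (inv_ne_zero hpos.ne') hnn

theorem centralRadius_pow_div_height {n : ℕ} {s : Fin n → ℝ} (hs : ∀ i, 0 < s i)
    {u : EuclideanSpace ℝ (Fin n)} (hu : ‖u‖ = 1) :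
    centralRadius s u ^ 3 / height s u =
      ‖normalize s (normalize s u)‖ / ‖normalize s u‖ ^ 4 := by
  rw [centralRadius_eq hs hu, height_eq hs hu]
  field_simp

/-! ### Linear substitution and the duality of integrals -/

theorem measure_preimage_normalize {n : ℕ} {s : Fin n → ℝ} (hs : ∀ i, 0 < s i)
    (t : Set (EuclideanSpace ℝ (Fin n))) :
    volume (normalize s ⁻¹' t) = ENNReal.ofReal (∏ i, s i) * volume t := by
  have hpos : 0 < ∏ i, s i := Finset.prod_pos fun i _ => hs i
  rw [Measure.addHaar_preimage_linearMap, det_normalize, Finset.prod_inv_distrib, inv_inv,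
    abs_of_pos hpos]
  rw [det_normalize, Finset.prod_inv_distrib]
  exact inv_ne_zero hpos.ne'

theorem lintegral_comp_normalize {n : ℕ} {s : Fin n → ℝ} (hs : ∀ i, 0 < s i)
    {F : EuclideanSpace ℝ (Fin n) → ENNReal} (hF : Measurable F) :
    ∫⁻ x, F (normalize s x) = ENNReal.ofReal (∏ i, s i) * ∫⁻ x, F x := by
  have hm := (continuous_normalize s).measurable
  rw [← lintegral_map hF hm, ← smul_eq_mul, ← lintegral_smul_measure]
  congr 1
  ext t ht
  rw [Measure.map_apply hm ht, measure_preimage_normalize hs]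
  simp

theorem volume_solid {n : ℕ} {s : Fin n → ℝ} (hs : ∀ i, 0 < s i) :
    volume (solid s) = ENNReal.ofReal (∏ i, s i) *
      volume (Metric.closedBall (0 : EuclideanSpace ℝ (Fin n)) 1) := by
  rw [← measure_preimage_normalize hs]
  congr 1
  ext x
  rw [solid, Set.mem_ofPred_eq, Set.mem_preimage, mem_closedBall_zero_iff, ← norm_normalize_sq,
    sq_le_one_iff₀ (norm_nonneg _)]

/-- Substitution of the ellipsoid for the unit sphere in an integral over the solid angle. -/
theorem lintegral_norm_normalize_duality {s : Fin 3 → ℝ} (hs : ∀ i, 0 < s i) :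
    ∫⁻ u, ENNReal.ofReal (‖normalize s (normalize s u)‖ / ‖normalize s u‖ ^ 4) ∂solidAngle =
      ENNReal.ofReal (∏ i, s i) * ∫⁻ u, ENNReal.ofReal ‖normalize s u‖ ∂solidAngle := by
  -- The factor `‖N x‖` is homogeneous of degree one, so with the Jacobian `r ^ 2` the radial
  -- integrand is `r ^ 3`: hence the constant `1 / 4` and the fourth power of the cutoff radius.
  set F : EuclideanSpace ℝ (Fin 3) → ENNReal := fun x =>
    ENNReal.ofReal ‖normalize s x‖ * (Set.Iio (1 : ℝ)).indicator 1 ‖x‖ with hF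
  have hn := (continuous_normalize s).measurable
  have hFm : Measurable F := (hn.norm.ennreal_ofReal).mul
    ((measurable_one.indicator measurableSet_Iio).comp measurable_norm)
  set k : ENNReal := ENNReal.ofReal (1 / 4) with hk
  have hk0 : k ≠ 0 := by simp [hk]
  have hkt : k ≠ ⊤ := ENNReal.ofReal_ne_top
  have hmom : ∀ R : ℝ, 0 ≤ R → ∫⁻ r in Set.Ioi (0 : ℝ),
      ENNReal.ofReal (r ^ 3) * (Set.Iio R).indicator 1 r = k * ENNReal.ofReal (R ^ 4) := by
    intro R hR
    rw [lintegral_Ioi_pow_mul_indicator 3 hR, hk, ← ENNReal.ofReal_mul (by norm_num)]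
    congr 1
    push_cast
    ring
  have hind : ∀ R : ℝ, Measurable fun r : ℝ =>
      ENNReal.ofReal (r ^ 3) * (Set.Iio R).indicator (1 : ℝ → ENNReal) r := fun R =>
    (by fun_prop : Measurable fun r : ℝ => ENNReal.ofReal (r ^ 3)).mul
      (measurable_one.indicator measurableSet_Iio)
  have hray1 : ∀ u : EuclideanSpace ℝ (Fin 3), ‖u‖ = 1 →
      ∫⁻ r in Set.Ioi (0 : ℝ), ENNReal.ofReal (r ^ 2) * F (r • u) =
        k * ENNReal.ofReal ‖normalize s u‖ := by
    intro u hu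
    have h := hmom 1 zero_le_one
    rw [one_pow, ENNReal.ofReal_one, mul_one] at h
    rw [← h, ← lintegral_mul_const _ (hind 1)]
    refine setLIntegral_congr_fun measurableSet_Ioi fun r hr => ?_
    have hr : 0 < r := hr
    simp only [hF, map_smul, norm_smul, hu, Real.norm_eq_abs, abs_of_pos hr, mul_one]
    rw [pow_succ r 2, ENNReal.ofReal_mul hr.le, ENNReal.ofReal_mul (by positivity)]
    ring
  have hray2 : ∀ u : EuclideanSpace ℝ (Fin 3), ‖u‖ = 1 →
      ∫⁻ r in Set.Ioi (0 : ℝ), ENNReal.ofReal (r ^ 2) * F (normalize s (r • u)) =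
        k * ENNReal.ofReal (‖normalize s (normalize s u)‖ / ‖normalize s u‖ ^ 4) := by
    intro u hu
    have hu0 : u ≠ 0 := by rintro rfl; simp at hu
    have hpos : 0 < ‖normalize s u‖ := norm_pos_iff.2 (normalize_ne_zero hs hu0)
    have h := hmom ‖normalize s u‖⁻¹ (by positivity)
    rw [div_eq_inv_mul, ← inv_pow, ENNReal.ofReal_mul (by positivity), ← mul_assoc, ← h,
      ← lintegral_mul_const _ (hind _)]
    refine setLIntegral_congr_fun measurableSet_Ioi fun r hr => ?_
    have hr : 0 < r := hr
    -- After the substitution the unit ball becomes the inside of the ellipsoid, and the ray is cut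
    -- at the central radius.
    have hi : (Set.Iio (1 : ℝ)).indicator (1 : ℝ → ENNReal) (r * ‖normalize s u‖) =
        (Set.Iio ‖normalize s u‖⁻¹).indicator 1 r := by
      have : r * ‖normalize s u‖ < 1 ↔ r < ‖normalize s u‖⁻¹ := by
        rw [← one_div, lt_div_iff₀ hpos]
      simp [Set.indicator_apply, this]
    simp only [hF, map_smul, norm_smul, Real.norm_eq_abs, abs_of_pos hr, hi]
    rw [pow_succ r 2, ENNReal.ofReal_mul hr.le, ENNReal.ofReal_mul (by positivity)]
    ring
  have h := lintegral_comp_normalize hs hFm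
  rw [lintegral_eq_lintegral_toSphere volume (F := fun x => F (normalize s x)) (hFm.comp hn),
    lintegral_eq_lintegral_toSphere volume hFm, finrank_euclideanSpace_fin] at h
  simp_rw [hray1 _ (norm_eq_of_mem_sphere _)] at h
  simp_rw [hray2 _ (norm_eq_of_mem_sphere _)] at h
  simp_rw [lintegral_const_mul' _ _ hkt] at h
  rw [mul_left_comm] at h
  exact (ENNReal.mul_right_inj hk0 hkt).1 h

/-! ### Real integrals over the solid angle -/

theorem setLIntegral_Ioo_ofReal {g : ℝ → ℝ} (hg : Continuous g) {a b : ℝ} (hab : a ≤ b)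
    (h0 : ∀ x ∈ Set.Ioc a b, 0 ≤ g x) :
    ∫⁻ x in Set.Ioo a b, ENNReal.ofReal (g x) = ENNReal.ofReal (∫ x in a..b, g x) := by
  rw [Measure.restrict_congr_set Ioo_ae_eq_Ioc, intervalIntegral.integral_of_le hab,
    ofReal_integral_eq_lintegral_ofReal (hg.intervalIntegrable a b).1]
  filter_upwards [ae_restrict_mem measurableSet_Ioc] with x hx using h0 x hx

/-- Continuity is asked only along unit vectors, since the integrand `‖N (N u)‖ / ‖N u‖ ^ 4` is
singular at the origin. -/
theorem integral_solidAngle (f : EuclideanSpace ℝ (Fin 3) → ℝ) (hf : Measurable f)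
    (h0 : ∀ x, 0 ≤ f x) (hc : Continuous fun q : ℝ × ℝ => f (direction q.1 q.2)) :
    ∫ u, f u ∂solidAngle =
      ∫ φ in (0 : ℝ)..2 * π, ∫ θ in (0 : ℝ)..π, f (direction θ φ) * Real.sin θ := by
  set J : ℝ → ℝ := fun φ => ∫ θ in (0 : ℝ)..π, f (direction θ φ) * Real.sin θ with hJ
  have hsin : ∀ θ ∈ Set.Ioc 0 π, 0 ≤ Real.sin θ := fun θ h =>
    Real.sin_nonneg_of_nonneg_of_le_pi h.1.le h.2
  have hJc : Continuous J := by
    refine intervalIntegral.continuous_parametric_intervalIntegral_of_continuous' ?_ 0 π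
    exact (hc.comp continuous_swap).mul (by fun_prop)
  have hJ0 : ∀ φ, 0 ≤ J φ := fun φ =>
    intervalIntegral.integral_nonneg Real.pi_pos.le fun θ hθ =>
      mul_nonneg (h0 _) (Real.sin_nonneg_of_nonneg_of_le_pi hθ.1 hθ.2)
  have hJp : Function.Periodic J (2 * π) := fun φ => by
    simp only [hJ, direction, Real.cos_add_two_pi, Real.sin_add_two_pi]
  have hin : ∀ φ, ∫⁻ θ in Set.Ioo 0 π,
      ENNReal.ofReal (Real.sin θ) * ENNReal.ofReal (f (direction θ φ)) =
        ENNReal.ofReal (J φ) := by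
    intro φ
    have hcφ : Continuous fun θ => f (direction θ φ) * Real.sin θ :=
      (hc.comp (by fun_prop : Continuous fun θ : ℝ => (θ, φ))).mul Real.continuous_sin
    refine Eq.trans (lintegral_congr fun θ => ?_) (setLIntegral_Ioo_ofReal hcφ Real.pi_pos.le
      fun θ hθ => mul_nonneg (h0 _) (hsin θ hθ))
    rw [mul_comm, ← ENNReal.ofReal_mul (h0 _)]
  -- Polar coordinates give longitudes in `(-π, π)`; periodicity moves them to `[0, 2π]`.
  have hper := hJp.intervalIntegral_add_eq (-π) 0
  rw [show -π + 2 * π = π by ring, zero_add] at hper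
  rw [integral_eq_lintegral_of_nonneg_ae (.of_forall fun _ => h0 _)
    (hf.comp measurable_subtype_coe).aestronglyMeasurable,
    lintegral_solidAngle (fun x => ENNReal.ofReal (f x)) hf.ennreal_ofReal]
  simp_rw [hin]
  rw [setLIntegral_Ioo_ofReal hJc (by linarith [Real.pi_pos]) fun φ _ => hJ0 φ, hper,
    ENNReal.toReal_ofReal]
  exact intervalIntegral.integral_nonneg (by positivity) fun φ _ => hJ0 φ

theorem continuous_direction : Continuous fun q : ℝ × ℝ => direction q.1 q.2 := by
  unfold direction
  fun_prop

/-! ### Area and arc length elements -/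

theorem hasDerivAt_toLp {n : ℕ} {f : ℝ → Fin n → ℝ} {f' : Fin n → ℝ} {t : ℝ}
    (hf : ∀ i, HasDerivAt (fun t => f t i) (f' i) t) :
    HasDerivAt (fun t => WithLp.toLp 2 (f t) : ℝ → EuclideanSpace ℝ (Fin n))
      (WithLp.toLp 2 f') t :=
  (PiLp.continuousLinearEquiv 2 ℝ fun _ : Fin n => ℝ).symm.toContinuousLinearMap.hasFDerivAt
    |>.comp_hasDerivAt t (hasDerivAt_pi.2 hf)

theorem hasDerivAt_euclideanSpace_three {f g h : ℝ → ℝ} {f' g' h' t : ℝ} (hf : HasDerivAt f f' t)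
    (hg : HasDerivAt g g' t) (hh : HasDerivAt h h' t) :
    HasDerivAt (fun t => (!₂[f t, g t, h t] : EuclideanSpace ℝ (Fin 3))) !₂[f', g', h'] t := by
  refine hasDerivAt_toLp fun i => ?_
  fin_cases i
  exacts [hf, hg, hh]

theorem hasDerivAt_euclideanSpace_two {f g : ℝ → ℝ} {f' g' t : ℝ} (hf : HasDerivAt f f' t)
    (hg : HasDerivAt g g' t) :
    HasDerivAt (fun t => (!₂[f t, g t] : EuclideanSpace ℝ (Fin 2))) !₂[f', g'] t := by
  refine hasDerivAt_toLp fun i => ?_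
  fin_cases i
  exacts [hf, hg]

/-- The cross product of the two tangent vectors is `a b c sin θ` times `N` of the direction with
angles `θ`, `φ`, and `U V - W²` is its squared length. The range of `θ` makes `sin θ` nonnegative,
so the root can be taken. -/
theorem areaElement_param {a b c : ℝ} (ha : 0 < a) (hb : 0 < b) (hc : 0 < c) {θ : ℝ} (φ : ℝ)
    (hθ : θ ∈ Set.Icc 0 π) : areaElement (param a b c) θ φ =
      a * b * c * (‖normalize ![a, b, c] (direction θ φ)‖ * Real.sin θ) := by
  have hs := Real.sin_nonneg_of_nonneg_of_le_pi hθ.1 hθ.2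
  have h1 : deriv (fun t => param a b c t φ) θ = !₂[a * -Real.sin θ,
      b * Real.cos θ * Real.cos φ, c * Real.cos θ * Real.sin φ] :=
    (hasDerivAt_euclideanSpace_three ((Real.hasDerivAt_cos θ).const_mul a)
      (((Real.hasDerivAt_sin θ).const_mul b).mul_const _)
      (((Real.hasDerivAt_sin θ).const_mul c).mul_const _)).deriv
  have h2 : deriv (fun t => param a b c θ t) φ = !₂[0,
      b * Real.sin θ * -Real.sin φ, c * Real.sin θ * Real.cos φ] :=
    (hasDerivAt_euclideanSpace_three (hasDerivAt_const φ (a * Real.cos θ))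
      ((Real.hasDerivAt_cos φ).const_mul _) ((Real.hasDerivAt_sin φ).const_mul _)).deriv
  have hsq : (a * b * c * (‖normalize ![a, b, c] (direction θ φ)‖ * Real.sin θ)) ^ 2 =
      b ^ 2 * c ^ 2 * Real.cos θ ^ 2 * Real.sin θ ^ 2 +
      a ^ 2 * c ^ 2 * (Real.sin θ * Real.cos φ) ^ 2 * Real.sin θ ^ 2 +
      a ^ 2 * b ^ 2 * (Real.sin θ * Real.sin φ) ^ 2 * Real.sin θ ^ 2 := by
    rw [mul_pow, mul_pow ‖_‖, norm_normalize_sq, form, Fin.sum_univ_three]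
    simp only [direction, Matrix.cons_val]
    field_simp
  rw [areaElement, h1, h2, ← Real.sqrt_sq (by positivity :
    0 ≤ a * b * c * (‖normalize ![a, b, c] (direction θ φ)‖ * Real.sin θ)), hsq,
    EuclideanSpace.norm_sq_eq, EuclideanSpace.norm_sq_eq, PiLp.inner_apply]
  simp only [Fin.sum_univ_three, Matrix.cons_val, Real.norm_eq_abs, sq_abs, RCLike.inner_apply,
    conj_trivial]
  congr 1
  -- Only the `b ^ 2 * c ^ 2` term needs a reduction: it carries `(sin² φ + cos² φ) ^ 2`, and `t ^ 2
  -- - 1 = (t + 1) (t - 1)` gives the coefficient.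
  linear_combination b ^ 2 * c ^ 2 * Real.cos θ ^ 2 * Real.sin θ ^ 2 *
    (Real.sin φ ^ 2 + Real.cos φ ^ 2 + 1) * Real.sin_sq_add_cos_sq φ

/-- A quarter turn takes the velocity to `(b cos φ, a sin φ)`, which is `a b` times `N` of the
direction of angle `φ`. -/
theorem norm_deriv_planeParam {a b : ℝ} (ha : 0 < a) (hb : 0 < b) (φ : ℝ) :
    ‖deriv (planeParam a b) φ‖ = a * b * ‖normalize ![a, b] (planeDirection φ)‖ := by
  have h : deriv (planeParam a b) φ = !₂[a * -Real.sin φ, b * Real.cos φ] :=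
    (hasDerivAt_euclideanSpace_two ((Real.hasDerivAt_cos φ).const_mul a)
      ((Real.hasDerivAt_sin φ).const_mul b)).deriv
  rw [h, ← sq_eq_sq₀ (norm_nonneg _) (by positivity), mul_pow, norm_normalize_sq,
    EuclideanSpace.norm_sq_eq, form, Fin.sum_univ_two, Fin.sum_univ_two]
  simp only [planeDirection, Matrix.cons_val, Real.norm_eq_abs, sq_abs]
  field_simp
  ring

theorem norm_planeDirection (φ : ℝ) : ‖planeDirection φ‖ = 1 := by
  rw [EuclideanSpace.norm_eq, Real.sqrt_eq_one, Fin.sum_univ_two]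
  simp [planeDirection]

/-! ### Surface area, volume and the final formulas -/

/-- The eccentric anomalies are reread as spherical angles on the unit sphere, so `sin θ dθ dφ` is
the solid angle there, although `u` is not the direction of the parametrized point. -/
theorem surfaceArea_eq {a b c : ℝ} (ha : 0 < a) (hb : 0 < b) (hc : 0 < c) :
    surfaceArea a b c = a * b * c * ∫ u, ‖normalize ![a, b, c] u‖ ∂solidAngle := by
  have hn := continuous_normalize ![a, b, c]
  rw [integral_solidAngle (fun u => ‖normalize ![a, b, c] u‖) hn.norm.measurable
    (fun _ => norm_nonneg _) (hn.comp continuous_direction).norm, surfaceArea,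
    ← intervalIntegral.integral_const_mul]
  refine intervalIntegral.integral_congr fun φ _ => ?_
  refine (intervalIntegral.integral_congr fun θ hθ => ?_).trans
    (intervalIntegral.integral_const_mul _ _)
  rw [Set.uIcc_of_le Real.pi_pos.le] at hθ
  exact areaElement_param ha hb hc φ hθ

theorem integral_norm_normalize_duality {s : Fin 3 → ℝ} (hs : ∀ i, 0 < s i) :
    ∫ u : Metric.sphere (0 : EuclideanSpace ℝ (Fin 3)) 1,
        ‖normalize s (normalize s u)‖ / ‖normalize s u‖ ^ 4 ∂solidAngle =
      (∏ i, s i) * ∫ u : Metric.sphere (0 : EuclideanSpace ℝ (Fin 3)) 1,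
        ‖normalize s u‖ ∂solidAngle := by
  have hn := (continuous_normalize s).measurable
  rw [integral_eq_lintegral_of_nonneg_ae (.of_forall fun _ => by positivity)
      (by fun_prop : Measurable _).aestronglyMeasurable,
    integral_eq_lintegral_of_nonneg_ae (.of_forall fun _ => by positivity)
      (by fun_prop : Measurable _).aestronglyMeasurable,
    lintegral_norm_normalize_duality hs, ENNReal.toReal_mul,
    ENNReal.toReal_ofReal (Finset.prod_nonneg fun i _ => (hs i).le)]

theorem semiaxes_three_pos {a b c : ℝ} (ha : 0 < a) (hb : 0 < b) (hc : 0 < c) (i : Fin 3) :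
    0 < (![a, b, c] : Fin 3 → ℝ) i := by
  fin_cases i
  exacts [ha, hb, hc]

theorem semiaxes_two_pos {a b : ℝ} (ha : 0 < a) (hb : 0 < b) (i : Fin 2) :
    0 < (![a, b] : Fin 2 → ℝ) i := by
  fin_cases i
  exacts [ha, hb]

theorem volume_real_solid_three {a b c : ℝ} (ha : 0 < a) (hb : 0 < b) (hc : 0 < c) :
    volume.real (solid ![a, b, c]) = 4 * π * a * b * c / 3 := by
  rw [Measure.real, volume_solid (semiaxes_three_pos ha hb hc), Fin.prod_univ_three,
    EuclideanSpace.volume_closedBall_fin_three, ENNReal.toReal_mul, ENNReal.toReal_mul,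
    ENNReal.toReal_pow]
  simp only [Matrix.cons_val]
  rw [ENNReal.toReal_ofReal (by positivity), ENNReal.toReal_ofReal (by positivity),
    ENNReal.toReal_ofReal (by positivity)]
  ring

theorem volume_real_solid_two {a b : ℝ} (ha : 0 < a) (hb : 0 < b) :
    volume.real (solid ![a, b]) = π * a * b := by
  rw [Measure.real, volume_solid (semiaxes_two_pos ha hb), Fin.prod_univ_two,
    EuclideanSpace.volume_closedBall_fin_two, ENNReal.toReal_mul, ENNReal.toReal_mul,
    ENNReal.toReal_pow]
  simp only [Matrix.cons_val]
  rw [ENNReal.toReal_ofReal (by positivity), ENNReal.toReal_ofReal zero_le_one,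
    ENNReal.toReal_ofReal Real.pi_pos.le]
  ring

theorem surfaceArea_div_volume_real_solid {a b c : ℝ} (ha : 0 < a) (hb : 0 < b) (hc : 0 < c) :
    surfaceArea a b c / volume.real (solid ![a, b, c]) =
      3 * ∫ u : Metric.sphere (0 : EuclideanSpace ℝ (Fin 3)) 1,
        1 / centralRadius ![a, b, c] u * (1 / (4 * π)) ∂solidAngle := by
  have h : ∀ u : Metric.sphere (0 : EuclideanSpace ℝ (Fin 3)) 1,
      1 / centralRadius ![a, b, c] u = ‖normalize ![a, b, c] u‖ := fun u => by
    rw [centralRadius_eq (semiaxes_three_pos ha hb hc) (norm_eq_of_mem_sphere u), one_div, inv_inv]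
  have hπ := Real.pi_pos
  simp_rw [h]
  rw [integral_mul_const, volume_real_solid_three ha hb hc, surfaceArea_eq ha hb hc]
  field_simp

theorem surfaceArea_eq_integral_norm_normalize {a b c : ℝ} (ha : 0 < a) (hb : 0 < b)
    (hc : 0 < c) :
    surfaceArea a b c = ∫ u : Metric.sphere (0 : EuclideanSpace ℝ (Fin 3)) 1,
      ‖normalize ![a, b, c] (normalize ![a, b, c] u)‖ / ‖normalize ![a, b, c] u‖ ^ 4
        ∂solidAngle := by
  rw [integral_norm_normalize_duality (semiaxes_three_pos ha hb hc), surfaceArea_eq ha hb hc,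
    Fin.prod_univ_three]
  rfl

theorem surfaceArea_eq_integral_direction {a b c : ℝ} (ha : 0 < a) (hb : 0 < b) (hc : 0 < c) :
    surfaceArea a b c = ∫ Φ in (0 : ℝ)..2 * π, ∫ Θ in (0 : ℝ)..π,
      centralRadius ![a, b, c] (direction Θ Φ) ^ 3 / height ![a, b, c] (direction Θ Φ) *
        Real.sin Θ := by
  have hs := semiaxes_three_pos ha hb hc
  have hn := continuous_normalize ![a, b, c]
  have hd := hn.comp continuous_direction
  rw [surfaceArea_eq_integral_norm_normalize ha hb hc, integral_solidAngle
    (fun u => ‖normalize ![a, b, c] (normalize ![a, b, c] u)‖ / ‖normalize ![a, b, c] u‖ ^ 4)]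
  · simp_rw [centralRadius_pow_div_height hs (norm_direction _ _)]
  · exact (hn.comp hn).norm.measurable.div (hn.norm.pow 4).measurable
  · exact fun _ => by positivity
  · refine (hn.comp hd).norm.div (hd.norm.pow 4) fun q => pow_ne_zero 4 (norm_ne_zero_iff.2
      (normalize_ne_zero hs fun h => ?_))
    simpa [h] using norm_direction q.1 q.2

theorem surfaceArea_eq_integral_solidAngle {a b c : ℝ} (ha : 0 < a) (hb : 0 < b) (hc : 0 < c) :
    surfaceArea a b c = ∫ u : Metric.sphere (0 : EuclideanSpace ℝ (Fin 3)) 1,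
      centralRadius ![a, b, c] u ^ 3 / height ![a, b, c] u ∂solidAngle := by
  rw [surfaceArea_eq_integral_norm_normalize ha hb hc]
  refine integral_congr_ae (.of_forall fun u => ?_)
  exact (centralRadius_pow_div_height (semiaxes_three_pos ha hb hc) (norm_eq_of_mem_sphere u)).symm

theorem ellipseLength_div_volume_real_solid {a b : ℝ} (ha : 0 < a) (hb : 0 < b) :
    ellipseLength a b / volume.real (solid ![a, b]) =
      2 * ∫ Φ in (0 : ℝ)..2 * π,
        1 / centralRadius ![a, b] (planeDirection Φ) * (1 / (2 * π)) := by
  have h : ∀ Φ, 1 / centralRadius ![a, b] (planeDirection Φ) =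
      ‖normalize ![a, b] (planeDirection Φ)‖ := fun Φ => by
    rw [centralRadius_eq (semiaxes_two_pos ha hb) (norm_planeDirection Φ), one_div, inv_inv]
  have hπ := Real.pi_pos
  simp_rw [h, ellipseLength, norm_deriv_planeParam ha hb]
  rw [intervalIntegral.integral_mul_const, intervalIntegral.integral_const_mul,
    volume_real_solid_two ha hb]
  field_simp

end Ellipsoid

end

theorem mainTheorem4 (a b c : ℝ) (ha : 0 < a) (hb : 0 < b) (hc : 0 < c) :
    -- the ellipsoid with semi-axes a, b, c
    (volume.real (Ellipsoid.solid ![a, b, c]) = 4 * π * a * b * c / 3 ∧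
      Ellipsoid.surfaceArea a b c / volume.real (Ellipsoid.solid ![a, b, c]) =
        3 * ∫ u : Metric.sphere (0 : EuclideanSpace ℝ (Fin 3)) 1,
          1 / Ellipsoid.centralRadius ![a, b, c] u * (1 / (4 * π)) ∂Ellipsoid.solidAngle) ∧
    (Ellipsoid.surfaceArea a b c =
        (∫ Φ in (0 : ℝ)..2 * π, ∫ Θ in (0 : ℝ)..π,
          Ellipsoid.centralRadius ![a, b, c] (Ellipsoid.direction Θ Φ) ^ 3 /
            Ellipsoid.height ![a, b, c] (Ellipsoid.direction Θ Φ) * Real.sin Θ) ∧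
      Ellipsoid.surfaceArea a b c =
        ∫ u : Metric.sphere (0 : EuclideanSpace ℝ (Fin 3)) 1,
          Ellipsoid.centralRadius ![a, b, c] u ^ 3 / Ellipsoid.height ![a, b, c] u
            ∂Ellipsoid.solidAngle) ∧
    -- the ellipse with semi-axes a, b
    (volume.real (Ellipsoid.solid ![a, b]) = π * a * b ∧
      Ellipsoid.ellipseLength a b / volume.real (Ellipsoid.solid ![a, b]) =
        2 * ∫ Φ in (0 : ℝ)..2 * π,
          1 / Ellipsoid.centralRadius ![a, b] (Ellipsoid.planeDirection Φ) *
            (1 / (2 * π))) := by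
  exact ⟨⟨Ellipsoid.volume_real_solid_three ha hb hc,
      Ellipsoid.surfaceArea_div_volume_real_solid ha hb hc⟩,
    ⟨Ellipsoid.surfaceArea_eq_integral_direction ha hb hc,
      Ellipsoid.surfaceArea_eq_integral_solidAngle ha hb hc⟩,
    Ellipsoid.volume_real_solid_two ha hb, Ellipsoid.ellipseLength_div_volume_real_solid ha hb⟩
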